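/- Let $k$ be an algebraically closed field, let $n\ge m\ge 2$ and $d\ge 1$ be integers, and let $R=k[X_0,\dots,X_m]$ with its standard grading and $\mathfrak m=(X_0,\dots,X_m)$. Let $f_0,\dots,f_n\in R$ be homogeneous of degree $d$ with $\gcd(f_0,\dots,f_n)=1$, and put $I=(f_0,\dots,f_n)$. Assume that the rational map $\phi=(f_0:\cdots:f_n):\mathbb P^m_k\dashrightarrow\mathbb P^n_k$ is generically finite onto its image, that is, its closed image has dimension $m$ (so $\phi$ is a parameterization). Let $\mathcal R_I=\bigoplus_{s\ge 0}I^s$ be the Rees algebra of $I$, viewed as an algebra over $B=k[T_0,\dots,T_n]$ via $T_j\mapsto f_j\in I^1$; it defines the closure $\Gamma\subset\mathbb P^m_k\times\mathbb P^n_k$ of the graph of $\phi$. Let $\pi:\Gamma\to\mathbb P^n_k$ be the projection, with fiber $\pi^{-1}(y)=\operatorname{Proj}(\mathcal R_I\otimes_B k(y))\subset\mathbb P^m_k$ at a closed point $y$, and set $$\mathcal Y_{m-1}=\{y\in\mathbb P^n_k \mid \dim\pi^{-1}(y)=m-1\}.$$ For every $y\in\mathcal Y_{m-1}$ the unmixed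 part of maximal dimension of $\pi^{-1}(y)$ (the intersection of the primary components of maximal dimension) is defined by a single homogeneous polynomial $h_y\in R$, which is unique up to a nonzero scalar. For an ideal $J\subset R$ let $J^{\mathrm{sat}}=\bigcup_N (J:_R\mathfrak m^N)$, and for a homogeneous ideal $J$ let $\operatorname{indeg}(J)$ be the least degree of a nonzero homogeneous element of $J$ ($+\infty$ if $J=0$). If for some integer $s\ge 1$ one has $\nu:=\operatorname{indeg}((I^s)^{\mathrm{sat}})<sd$, then $\mathcal Y_{m-1}$ is finite and $$\sum_{y\in\mathcal Y_{m-1}}\deg(h_y)\le\nu<sd.$$ In particular, if $\operatorname{indeg}(I^{\mathrm{sat}})<d$, then $\sum_{y\in\mathcal Y_{m-1}}\deg(h_y)<d$. -/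

import Mathlib

open scoped LinearAlgebra.Projectivization

namespace RationalMapFibers

attribute [local instance] MvPolynomial.gradedAlgebra

/-- The homogeneous coordinate ring `k[X_0, …, X_r]` of projective `r`-space. -/
abbrev CoordRing (k : Type*) [Field k] (r : ℕ) : Type _ := MvPolynomial (Fin (r + 1)) k

variable {k : Type*} [Field k]

/-- The closed subset `V(J)` of `Proj k[X_0, …, X_r]`, with its Zariski topology. It is the
underlying space of the closed subscheme `Proj (k[X_0, …, X_r] / J)` when `J` is homogeneous. -/
noncomputable abbrev projLocus {r : ℕ} (J : Ideal (CoordRing k r)) :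
    Set (ProjectiveSpectrum (MvPolynomial.homogeneousSubmodule (Fin (r + 1)) k)) :=
  ProjectiveSpectrum.zeroLocus (MvPolynomial.homogeneousSubmodule (Fin (r + 1)) k) (J : Set _)

/-- The homogeneous maximal ideal `(X_0, …, X_r)`. -/
noncomputable def irrelevantIdeal (k : Type*) [Field k] (r : ℕ) : Ideal (CoordRing k r) :=
  Ideal.span (Set.range MvPolynomial.X)

/-- The saturation `J : (X_0, …, X_r)^∞`, the (increasing) union of the ideals
`J : (X_0, …, X_r)^N`. -/
noncomputable def saturation {r : ℕ} (J : Ideal (CoordRing k r)) : Ideal (CoordRing k r) :=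
  ⨆ N : ℕ, J.colon ((irrelevantIdeal k r ^ N : Ideal (CoordRing k r)) : Set (CoordRing k r))

/-- The initial degree of a homogeneous ideal: the least degree of a nonzero homogeneous
element, and `⊤` for the zero ideal. -/
noncomputable def indeg {r : ℕ} (J : Ideal (CoordRing k r)) : ℕ∞ :=
  ⨅ (e : ℕ) (_ : ∃ F ∈ J, F ≠ 0 ∧ F.IsHomogeneous e), (e : ℕ∞)

/-- The base ideal `I = (f_0, …, f_n)`. -/
noncomputable def baseIdeal {m n : ℕ} (f : Fin (n + 1) → CoordRing k m) : Ideal (CoordRing k m) :=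
  Ideal.span (Set.range f)

/-- The homogeneous ideal of the closed image of `(f_0 : ⋯ : f_n)` in `ℙ^n`: the kernel of
`k[T_0, …, T_n] → k[X_0, …, X_m]`, `T_j ↦ f_j`. -/
noncomputable def closedImageIdeal {m n : ℕ} (f : Fin (n + 1) → CoordRing k m) :
    Ideal (CoordRing k n) :=
  RingHom.ker (MvPolynomial.aeval f : CoordRing k n →ₐ[k] CoordRing k m)

/-- `f_0, …, f_n` are forms of degree `d` without common factor and the rational map
`(f_0 : ⋯ : f_n) : ℙ^m ⇢ ℙ^n` is generically finite onto its image, that is, its closed image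
has dimension `m`. -/
structure IsParameterization {m n : ℕ} (f : Fin (n + 1) → CoordRing k m) (d : ℕ) : Prop where
  isHomogeneous : ∀ j, (f j).IsHomogeneous d
  isUnit_of_dvd : ∀ q : CoordRing k m, (∀ j, q ∣ f j) → IsUnit q
  dim_closedImage : topologicalKrullDim (projLocus (closedImageIdeal f)) = (m : WithBot ℕ∞)

/-- The presentation `R[T_0, …, T_n] → Rees_R(I) = ⨁ I^s t^s`, `T_j ↦ f_j t`, of the Rees
algebra of the base ideal. -/
noncomputable def reesMap {m n : ℕ} (f : Fin (n + 1) → CoordRing k m) :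
    MvPolynomial (Fin (n + 1)) (CoordRing k m) →ₐ[CoordRing k m] reesAlgebra (baseIdeal f) :=
  MvPolynomial.aeval fun j =>
    ⟨Polynomial.monomial 1 (f j), reesAlgebra.monomial_mem.2 (by
      rw [pow_one]
      exact Ideal.subset_span ⟨j, rfl⟩)⟩

/-- The ideal of `R = k[X_0, …, X_m]` obtained by substituting the coordinates `p` of a point
of `ℙ^n` for `T` in the equations of `Γ`, i.e. in the elements of the kernel of
`R[T] → Rees_R(I)`. As `R[T] ⊗_B k = R` along the evaluation `B = k[T] → k` at `p`, the quotient
of `R` by this ideal is `Rees_R(I) ⊗_B k(y)`, `y = [p]`. -/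
noncomputable def fiberIdeal {m n : ℕ} (f : Fin (n + 1) → CoordRing k m) (p : Fin (n + 1) → k) :
    Ideal (CoordRing k m) :=
  (RingHom.ker (reesMap f)).map
    (MvPolynomial.eval fun j => (MvPolynomial.C (p j) : CoordRing k m))

/-- The closed points `y` of `ℙ^n` whose fiber `π⁻¹(y) = Proj (Rees_R(I) ⊗_B k(y))` under
`π : Γ → ℙ^n` has dimension `l`. (The fiber ideal does not depend on the chosen
representative of `y`, since the equations of `Γ` are homogeneous in `T`.) -/
noncomputable def fiberDimSet {m n : ℕ} (f : Fin (n + 1) → CoordRing k m) (l : ℕ) :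
    Set (ℙ k (Fin (n + 1) → k)) :=
  {y | topologicalKrullDim (projLocus (fiberIdeal f y.rep)) = (l : WithBot ℕ∞)}

/-- The unmixed part of maximal dimension of an ideal `J` of a Noetherian ring `A`: the
intersection of the `P`-primary components of `J` for the primes `P` minimal over `J` with
`dim A/P = dim A/J`. The `P`-primary component is the contraction of `J A_P`. -/
noncomputable def unmixedPart {A : Type*} [CommRing A] (J : Ideal A) : Ideal A :=
  ⨅ (P : Ideal A) (_ : P.IsPrime)
    (_ : P ∈ J.minimalPrimes ∧ ringKrullDim (A ⧸ P) = ringKrullDim (A ⧸ J)),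
    (J.map (algebraMap A (Localization.AtPrime P))).comap (algebraMap A (Localization.AtPrime P))

/-- `h` is an equation `h_y` of the fiber `π⁻¹(y)`: a homogeneous polynomial defining the
unmixed part of maximal dimension of the fiber. -/
def IsFiberEquation {m n : ℕ} (f : Fin (n + 1) → CoordRing k m) (y : ℙ k (Fin (n + 1) → k))
    (h : CoordRing k m) : Prop :=
  h.IsHomogeneous h.totalDegree ∧ Ideal.span {h} = unmixedPart (fiberIdeal f y.rep)

end RationalMapFibers

/-!
Let `p` represent a point `y` with an `(m - 1)`-dimensional fiber. The relations
`f_i T_j - f_j T_i` vanish on the graph, so the fiber ideal `J` contains the minors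
`p_i f_j - p_j f_i`. They are forms of degree `d`, and they are not all zero because the `f_j`
have no common factor.

*Existence of `h_y`.* Adding the irrelevant ideal to chains of homogeneous primes gives
`dim R/J ≥ m`, while `J ≠ 0` and `dim R = m + 1`. Hence a minimal prime `P` of `J` with
`dim R/P = dim R/J` is generated by a prime element `q`, and the `P`-primary component of `J` is
generated by a power of `q`. A finite intersection of principal ideals in a factorial ring is
principal, and its generator is homogeneous because it divides a nonzero minor.

*The bound.* The form `h_y` divides all minors `p_i f_j - p_j f_i`, since these lie in its ideal.
If `p_i ≠ 0`, this says that `I ⊆ (f_i, h_y)`, whence `I ^ s ⊆ (f_i ^ s, h_y)`. Moreover `f_i` and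
`h_y` are coprime, and an ideal generated by two coprime polynomials in at least three variables
is saturated (`mem_span_pair_of_X_mul_mem`). So a nonzero form `F` of degree `ν < s d` in the
saturation of `I ^ s` lies in `(f_i ^ s, h_y)`, and comparing degrees gives `h_y ∣ F`
(`IsParameterization.dvd_of_mem_saturation`). For distinct points the `h_y` are coprime, because a
common factor would divide all `f_j`; so the product of any finitely many of them divides `F`.
As each `h_y` has positive degree, there are finitely many, of total degree at most `ν`.
-/

namespace RationalMapFibers

open MvPolynomial

attribute [local instance] MvPolynomial.gradedAlgebra

/-! ### Divisibility and homogeneous polynomials -/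

section Homogeneity

variable {k σ : Type*} [Field k]

/-- Order and total degree are both additive and agree exactly on homogeneous polynomials, so a
divisor of a nonzero homogeneous polynomial is homogeneous. -/
theorem isHomogeneous_of_dvd {g h : MvPolynomial σ k} {D : ℕ} (hg : g.IsHomogeneous D)
    (hg0 : g ≠ 0) (hdvd : h ∣ g) : h.IsHomogeneous h.totalDegree := by
  obtain ⟨q, rfl⟩ := hdvd
  have hh0 : h ≠ 0 := left_ne_zero_of_mul hg0
  have hq0 : q ≠ 0 := right_ne_zero_of_mul hg0
  have hle : ∀ {p : MvPolynomial σ k}, p ≠ 0 → (p : MvPowerSeries σ k).order ≤ p.totalDegree := by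
    intro p hp
    obtain ⟨d, hd⟩ := MvPolynomial.ne_zero_iff.1 hp
    refine (MvPowerSeries.order_le (d := d) (by simpa using hd)).trans ?_
    rw [Finsupp.degree_apply]
    exact_mod_cast le_totalDegree (mem_support_iff.2 hd)
  have hD : (D : ℕ∞) ≤ ((h * q : MvPolynomial σ k) : MvPowerSeries σ k).order := by
    refine MvPowerSeries.nat_le_order fun d hd => ?_
    rw [MvPolynomial.coeff_coe]
    exact hg.coeff_eq_zero hd.ne
  rw [coe_mul, MvPowerSeries.order_mul] at hD
  have htot : h.totalDegree + q.totalDegree = D := by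
    rw [← totalDegree_mul_of_isDomain hh0 hq0, hg.totalDegree hg0]
  have hq := hle hq0
  have hord : (h.totalDegree : ℕ∞) ≤ (h : MvPowerSeries σ k).order := by
    have h1 : (h.totalDegree : ℕ∞) + q.totalDegree ≤
        (h : MvPowerSeries σ k).order + q.totalDegree := by
      refine le_trans ?_ (hD.trans (by gcongr))
      exact_mod_cast htot.le
    exact (WithTop.add_le_add_iff_right (ENat.natCast_ne_top _)).1 h1
  intro d hd
  rw [Pi.one_def, ← Finsupp.degree_eq_weight_one]
  refine le_antisymm ?_ ?_
  · rw [Finsupp.degree_apply]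
    exact le_totalDegree (mem_support_iff.2 hd)
  · exact_mod_cast hord.trans (MvPowerSeries.order_le (d := d) (by simpa using hd))

/-- In degree `ν < deg G` the ideals `(G, h)` and `(h)` agree. -/
theorem dvd_of_isHomogeneous_of_mem_span_pair {F G h : MvPolynomial σ k} {ν N e : ℕ}
    (hF : F.IsHomogeneous ν) (hG : G.IsHomogeneous N) (hh : h.IsHomogeneous e) (hν : ν < N)
    (hmem : F ∈ Ideal.span {G, h}) : h ∣ F := by
  obtain ⟨u, v, huv⟩ := Ideal.mem_span_pair.1 hmem
  have h1 := DirectSum.coe_decompose_mul_of_right_mem_of_not_le (homogeneousSubmodule σ k)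
    (n := ν) (a := u) (b := G) (i := N) hG (by omega)
  have h2 := DirectSum.coe_decompose_mul_of_right_mem (homogeneousSubmodule σ k)
    ν (a := v) (b := h) (i := e) hh
  have h3 := DirectSum.decompose_of_mem_same (homogeneousSubmodule σ k) (x := F) (i := ν) hF
  rw [← huv, DirectSum.decompose_add, DirectSum.add_apply, Submodule.coe_add, h1, h2, zero_add,
    huv] at h3
  rw [← h3]
  split_ifs
  · exact dvd_mul_left _ _
  · exact dvd_zero _

end Homogeneity

/-! ### Saturation and initial degree -/

section Saturation

variable {k σ : Type*} [Field k]

/-- A variable is a nonzerodivisor modulo two others. -/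
theorem mem_span_X_pair_of_X_mul_mem {i j l : σ} (hil : l ≠ i) (hjl : l ≠ j)
    {w : MvPolynomial σ k} (h : X l * w ∈ Ideal.span {(X i : MvPolynomial σ k), X j}) :
    w ∈ Ideal.span {(X i : MvPolynomial σ k), X j} := by
  rw [← Set.image_pair, mem_ideal_span_X_image] at h ⊢
  intro d hd
  obtain ⟨a, ha, hda⟩ := h (Finsupp.single l 1 + d) (by
    rw [mem_support_iff, coeff_X_mul]; exact mem_support_iff.1 hd)
  refine ⟨a, ha, ?_⟩
  have : l ≠ a := by rintro rfl; simp_all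
  simpa [Finsupp.single_apply, this] using hda

/-- The quotient by two coprime polynomials has no nonzero element killed by three variables; this
is where the dimension hypothesis `2 ≤ m` is needed. Writing `X F = u a + v b` for each of
the variables, the syzygies between the coefficients `u` form a Koszul cycle with entries `w`; as
this cycle is a boundary, `u` and `v` can be corrected by a trivial syzygy of `(a, b)` so as to
become divisible by the variable. -/
theorem mem_span_pair_of_X_mul_mem {i j l : σ} (hij : i ≠ j) (hil : l ≠ i) (hjl : l ≠ j)
    {a b F : MvPolynomial σ k} (hb : b ≠ 0) (hab : IsRelPrime b a)
    (hi : X i * F ∈ Ideal.span {a, b}) (hj : X j * F ∈ Ideal.span {a, b})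
    (hl : X l * F ∈ Ideal.span {a, b}) : F ∈ Ideal.span {a, b} := by
  obtain ⟨u₀, v₀, h₀⟩ := Ideal.mem_span_pair.1 hi
  obtain ⟨u₁, v₁, h₁⟩ := Ideal.mem_span_pair.1 hj
  obtain ⟨u₂, v₂, h₂⟩ := Ideal.mem_span_pair.1 hl
  have key : ∀ {c c' u v u' v' : MvPolynomial σ k}, u * a + v * b = c * F →
      u' * a + v' * b = c' * F → ∃ w, c' * u - c * u' = b * w ∧ c * v' - c' * v = a * w := by
    intro c c' u v u' v' h h'
    have e : a * (c' * u - c * u') = b * (c * v' - c' * v) := by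
      linear_combination c' * h - c * h'
    obtain ⟨w, hw⟩ := hab.dvd_of_dvd_mul_left (Dvd.intro _ e.symm)
    refine ⟨w, hw, mul_left_cancel₀ hb ?_⟩
    rw [← e, hw]; ring
  obtain ⟨w₀₁, hu, hv⟩ := key h₀ h₁
  obtain ⟨w₀₂, hu₀₂, -⟩ := key h₀ h₂
  obtain ⟨w₁₂, hu₁₂, -⟩ := key h₁ h₂
  have hcyc : X l * w₀₁ = (-w₁₂) * X i + w₀₂ * X j := by
    refine mul_left_cancel₀ hb ?_
    linear_combination (-X l) * hu + X j * hu₀₂ - X i * hu₁₂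
  -- `w₀₁` is an entry of a Koszul boundary.
  obtain ⟨z₁, z₀, hw⟩ := Ideal.mem_span_pair.1
    (mem_span_X_pair_of_X_mul_mem hil hjl (Ideal.mem_span_pair.2 ⟨_, _, hcyc.symm⟩))
  have hXij : ¬ (X i : MvPolynomial σ k) ∣ X j := by
    rw [X_dvd_X]
    simpa using hij
  have hX : ∀ {x y : MvPolynomial σ k}, X j * x = X i * y → ∃ t, x = X i * t := fun {x y} h =>
    ((X_prime (i := i)).dvd_or_dvd (Dvd.intro _ h.symm)).resolve_left hXij
  obtain ⟨t, ht⟩ : ∃ t, u₀ - b * z₀ = X i * t :=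
    hX (y := u₁ + b * z₁) (by linear_combination hu - b * hw)
  obtain ⟨t', ht'⟩ : ∃ t, v₀ + a * z₀ = X i * t :=
    hX (y := v₁ - a * z₁) (by linear_combination a * hw - hv)
  refine Ideal.mem_span_pair.2 ⟨t, t', mul_left_cancel₀ (X_ne_zero i) ?_⟩
  linear_combination h₀ - a * ht - b * ht'

theorem saturation_le_of_forall_X_mul_mem {r : ℕ} {J K : Ideal (CoordRing k r)} (hJK : J ≤ K)
    (hK : ∀ F : CoordRing k r, (∀ i, X i * F ∈ K) → F ∈ K) : saturation J ≤ K := by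
  refine iSup_le fun N => ?_
  induction N with
  | zero =>
    intro F hF
    rw [Submodule.mem_colon] at hF
    simpa using hJK (hF 1 (by simp))
  | succ N ih =>
    intro F hF
    refine hK F fun i => ih ?_
    rw [Submodule.mem_colon] at hF ⊢
    intro p hp
    have := hF (p * X i) (by
      rw [pow_succ]
      exact Ideal.mul_mem_mul hp (Ideal.subset_span ⟨i, rfl⟩))
    simpa [smul_eq_mul, mul_comm, mul_left_comm] using this

theorem saturation_le_span_pair {r : ℕ} (hr : 2 ≤ r) {J : Ideal (CoordRing k r)}
    {a b : CoordRing k r} (hb : b ≠ 0) (hab : IsRelPrime b a) (hJ : J ≤ Ideal.span {a, b}) :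
    saturation J ≤ Ideal.span {a, b} := by
  refine saturation_le_of_forall_X_mul_mem hJ fun F hF => ?_
  exact mem_span_pair_of_X_mul_mem (i := (⟨0, by omega⟩ : Fin (r + 1)))
    (j := ⟨1, by omega⟩) (l := ⟨2, by omega⟩) (by simp) (by simp) (by simp) hb hab
    (hF _) (hF _) (hF _)

theorem exists_of_indeg_eq {r ν : ℕ} {J : Ideal (CoordRing k r)} (h : indeg J = ν) :
    ∃ F ∈ J, F ≠ 0 ∧ F.IsHomogeneous ν := by
  have hlt : indeg J < ((ν + 1 : ℕ) : ℕ∞) := by rw [h]; exact_mod_cast ν.lt_succ_self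
  simp only [indeg, iInf_lt_iff] at hlt
  obtain ⟨e, he, hlt⟩ := hlt
  have hle : (ν : ℕ∞) ≤ e := h ▸ iInf₂_le e he
  have : e = ν := by
    have h1 : e < ν + 1 := by exact_mod_cast hlt
    have h2 : ν ≤ e := by exact_mod_cast hle
    omega
  exact this ▸ he

end Saturation

/-! ### Dimension of projective loci -/

section Dimension

variable {k : Type*} [Field k] {r : ℕ}

theorem le_ker_constantCoeff (x : ProjectiveSpectrum (homogeneousSubmodule (Fin (r + 1)) k)) :
    x.asHomogeneousIdeal.toIdeal ≤
      RingHom.ker (constantCoeff : CoordRing k r →+* k) := by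
  intro F hF
  have h0 := x.asHomogeneousIdeal.isHomogeneous 0 hF
  have hC : ((DirectSum.decompose (homogeneousSubmodule (Fin (r + 1)) k) F 0 :
      homogeneousSubmodule (Fin (r + 1)) k 0) : CoordRing k r) = C (constantCoeff F) := by
    have := decomposition.decompose'_apply F 0
    rw [homogeneousComponent_zero] at this
    exact this
  rw [hC] at h0
  by_contra hne
  rw [RingHom.mem_ker] at hne
  exact x.isPrime.ne_top (Ideal.eq_top_of_isUnit_mem _ h0 ((IsUnit.mk0 _ hne).map C))

theorem asIdeal_ne_ker_constantCoeff
    (x : ProjectiveSpectrum (homogeneousSubmodule (Fin (r + 1)) k)) :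
    x.asHomogeneousIdeal.toIdeal ≠ RingHom.ker (constantCoeff : CoordRing k r →+* k) := by
  intro h
  refine x.not_irrelevant_le ?_
  rw [HomogeneousIdeal.irrelevant_le]
  intro i hi F hF
  change F ∈ x.asHomogeneousIdeal.toIdeal
  rw [h, RingHom.mem_ker]
  exact (IsHomogeneous.coeff_eq_zero hF (by simpa using hi.ne))

theorem isPrime_vanishingIdeal {Z : Set (ProjectiveSpectrum (homogeneousSubmodule (Fin (r + 1)) k))}
    (hZ : IsIrreducible Z) : (ProjectiveSpectrum.vanishingIdeal Z).toIdeal.IsPrime := by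
  refine ⟨?_, fun {a b} hab => ?_⟩
  · obtain ⟨x, hx⟩ := hZ.1
    intro h
    refine x.isPrime.ne_top ((Ideal.eq_top_iff_one _).2 ?_)
    exact (ProjectiveSpectrum.mem_vanishingIdeal Z 1).1 ((Ideal.eq_top_iff_one _).1 h) x hx
  · have key : ∀ c : CoordRing k r, Z ⊆ ProjectiveSpectrum.zeroLocus _ {c} →
        c ∈ (ProjectiveSpectrum.vanishingIdeal Z).toIdeal := fun c hc =>
      (ProjectiveSpectrum.mem_vanishingIdeal Z c).2 fun x hx => by
        simpa using hc hx
    refine (isPreirreducible_iff_isClosed_union_isClosed.1 hZ.2 _ _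
      (ProjectiveSpectrum.isClosed_zeroLocus _ {a})
      (ProjectiveSpectrum.isClosed_zeroLocus _ {b}) ?_).imp (key a) (key b)
    rw [← ProjectiveSpectrum.zeroLocus_singleton_mul]
    intro x hx
    simpa using (ProjectiveSpectrum.mem_vanishingIdeal Z _).1 hab x hx

/-- The affine cone over a projective locus has dimension at least one more: below the irreducible
closed subsets one adds the vertex, given by the ideal `(X_0, …, X_r)`. It is encoded as the kernel
of the constant coefficient map, and corresponds to the added bottom element. -/
theorem topologicalKrullDim_projLocus_add_one_le {J : Ideal (CoordRing k r)}
    (hne : (projLocus J).Nonempty) :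
    topologicalKrullDim (projLocus J) + 1 ≤ ringKrullDim (CoordRing k r ⧸ J) := by
  classical
  obtain ⟨x, hx⟩ := hne
  have : Nonempty (TopologicalSpace.IrreducibleCloseds (projLocus J)) :=
    ⟨⟨closure {⟨x, hx⟩}, isIrreducible_singleton.closure, isClosed_closure⟩⟩
  rw [topologicalKrullDim, ← Order.krullDim_withBot, ringKrullDim_quotient,
    ← Order.krullDim_orderDual (α := PrimeSpectrum.zeroLocus _)]
  -- `I Z` is the prime ideal of the irreducible closed subset `Z`.
  let I (Z : TopologicalSpace.IrreducibleCloseds (projLocus J)) : Ideal (CoordRing k r) :=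
    (ProjectiveSpectrum.vanishingIdeal (Subtype.val '' (Z : Set (projLocus J)))).toIdeal
  have hcl (Z : TopologicalSpace.IrreducibleCloseds (projLocus J)) :
      IsClosed (Subtype.val '' (Z : Set (projLocus J))) :=
    (ProjectiveSpectrum.isClosed_zeroLocus _ _).isClosedMap_subtype_val _ Z.isClosed'
  have hprime (Z) : (I Z).IsPrime := isPrime_vanishingIdeal
    (Z.isIrreducible'.image _ continuous_subtype_val.continuousOn)
  have hJ (Z) : J ≤ I Z := by
    rw [← ProjectiveSpectrum.subset_zeroLocus_iff_le_vanishingIdeal]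
    rintro _ ⟨z, -, rfl⟩
    exact z.2
  have hlt (Z) : I Z < RingHom.ker (constantCoeff : CoordRing k r →+* k) := by
    obtain ⟨z, hz⟩ := Z.isIrreducible'.1
    have hz' : I Z ≤ z.1.asHomogeneousIdeal.toIdeal := fun F hF =>
      (ProjectiveSpectrum.mem_vanishingIdeal _ F).1 hF z.1 ⟨z, hz, rfl⟩
    exact hz'.trans_lt (lt_of_le_of_ne (le_ker_constantCoeff _) (asIdeal_ne_ker_constantCoeff _))
  have hanti {Z W} (h : Z < W) : I W < I Z := by
    refine lt_of_le_of_ne (fun F hF =>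
      (ProjectiveSpectrum.mem_vanishingIdeal _ F).2 fun z hz =>
        (ProjectiveSpectrum.mem_vanishingIdeal _ F).1 hF z (Set.image_mono h.le hz)) fun heq => h.ne ?_
    have h1 := congrArg (fun K : Ideal (CoordRing k r) =>
      ProjectiveSpectrum.zeroLocus (homogeneousSubmodule (Fin (r + 1)) k) (K : Set _)) heq
    have h2 (Z) : ProjectiveSpectrum.zeroLocus (homogeneousSubmodule (Fin (r + 1)) k)
        (I Z : Set (CoordRing k r)) = Subtype.val '' (Z : Set (projLocus J)) :=
      (ProjectiveSpectrum.zeroLocus_vanishingIdeal_eq_closure _ _).trans (hcl Z).closure_eq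
    simp only [h2] at h1
    exact SetLike.coe_injective (Subtype.val_injective.image_injective h1.symm)
  have hker : J ≤ RingHom.ker (constantCoeff : CoordRing k r →+* k) :=
    (hJ this.some).trans (hlt _).le
  let Φ : WithBot (TopologicalSpace.IrreducibleCloseds (projLocus J)) →
      (PrimeSpectrum.zeroLocus (J : Set (CoordRing k r)))ᵒᵈ :=
    WithBot.recBotCoe (OrderDual.toDual ⟨⟨_, RingHom.ker_isPrime constantCoeff⟩, hker⟩)
      fun Z => OrderDual.toDual ⟨⟨I Z, hprime Z⟩, hJ Z⟩
  refine Order.krullDim_le_of_strictMono Φ (WithBot.strictMono_iff.2 ⟨fun Z W h => ?_, fun Z => ?_⟩)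
  · exact hanti h
  · exact hlt Z

end Dimension

/-! ### The unmixed part of maximal dimension -/

section Unmixed

/-- A nonzero prime of coheight at least `dim A - 1` is generated by any prime element it contains. -/
theorem eq_span_singleton_of_le_ringKrullDim_quotient {A : Type*} [CommRing A] [IsDomain A]
    {m : ℕ} (hA : ringKrullDim A ≤ (m + 1 : ℕ)) {P : Ideal A} [P.IsPrime]
    (hP : (m : WithBot ℕ∞) ≤ ringKrullDim (A ⧸ P)) {q : A} (hq : Prime q) (hqP : q ∈ P) :
    P = Ideal.span {q} := by
  have hle : Ideal.span {q} ≤ P := (Ideal.span_singleton_le_iff_mem P).2 hqP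
  by_contra hne
  obtain ⟨x, hxP, hxq⟩ := SetLike.exists_of_lt (lt_of_le_of_ne hle (Ne.symm hne))
  have := (Ideal.span_singleton_prime hq.ne_zero).2 hq
  have h1 : ringKrullDim (A ⧸ P) + 1 ≤ ringKrullDim (A ⧸ Ideal.span {q}) :=
    ringKrullDim_succ_le_of_surjective (Ideal.Quotient.factor hle)
      (Ideal.Quotient.factor_surjective hle) (r := Ideal.Quotient.mk _ x)
      (mem_nonZeroDivisors_of_ne_zero (by rwa [Ne, Ideal.Quotient.eq_zero_iff_mem]))
      (by simpa [Ideal.Quotient.eq_zero_iff_mem] using hxP)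
  have h2 := ringKrullDim_quotient_succ_le_of_nonZeroDivisor
    (mem_nonZeroDivisors_of_ne_zero hq.ne_zero)
  have h3 : ((m + 1 + 1 : ℕ) : WithBot ℕ∞) ≤ (m + 1 : ℕ) := by
    refine le_trans ?_ hA
    refine le_trans ?_ h2
    push_cast
    gcongr
    exact le_trans (by gcongr) h1
  have : m + 1 + 1 ≤ m + 1 := by exact_mod_cast h3
  omega

/-- The `(q)`-primary component of `J` is generated by `q ^ a`, where `a` is the least multiplicity
of `q` in a nonzero element of `J`. -/
theorem exists_comap_map_localization_eq_span_singleton {A : Type*} [CommRing A] [IsDomain A]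
    [UniqueFactorizationMonoid A] {J P : Ideal A} [P.IsPrime] (hJ : J ≠ ⊥) {q : A} (hq : Prime q)
    (hP : P = Ideal.span {q}) :
    ∃ c, (J.map (algebraMap A (Localization.AtPrime P))).comap
      (algebraMap A (Localization.AtPrime P)) = Ideal.span {c} := by
  classical
  have hmem (x : A) : x ∉ P ↔ ¬ q ∣ x := by rw [hP, Ideal.mem_span_singleton]
  have hfin : ∀ x ∈ J, x ≠ 0 → FiniteMultiplicity q x := fun x _ hx =>
    FiniteMultiplicity.of_prime_left hq hx
  have hex : ∃ a, ∃ x ∈ J, ∃ u, ¬ q ∣ u ∧ x = q ^ a * u := by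
    obtain ⟨x, hxJ, hx⟩ := Submodule.exists_mem_ne_zero_of_ne_bot hJ
    obtain ⟨u, hu, hqu⟩ := (hfin x hxJ hx).exists_eq_pow_mul_and_not_dvd
    exact ⟨_, x, hxJ, u, hqu, hu⟩
  obtain ⟨g, hgJ, u, hqu, hgu⟩ := Nat.find_spec hex
  have hdvd : ∀ x ∈ J, q ^ Nat.find hex ∣ x := by
    intro x hxJ
    rcases eq_or_ne x 0 with rfl | hx
    · exact dvd_zero _
    obtain ⟨v, hv, hqv⟩ := (hfin x hxJ hx).exists_eq_pow_mul_and_not_dvd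
    have := Nat.find_min' hex ⟨x, hxJ, v, hqv, hv⟩
    exact (pow_dvd_pow q this).trans (Dvd.intro _ hv.symm)
  refine ⟨q ^ Nat.find hex, le_antisymm (fun x hx => ?_) ?_⟩
  · rw [Ideal.mem_comap, IsLocalization.algebraMap_mem_map_algebraMap_iff P.primeCompl] at hx
    obtain ⟨s, hs, hsx⟩ := hx
    rw [Ideal.mem_span_singleton]
    exact hq.pow_dvd_of_dvd_mul_left _ ((hmem s).1 hs) (hdvd _ hsx)
  · rw [Ideal.span_singleton_le_iff_mem, Ideal.mem_comap,
      IsLocalization.algebraMap_mem_map_algebraMap_iff P.primeCompl]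
    exact ⟨u, (hmem u).2 hqu, by rwa [mul_comm, ← hgu]⟩

theorem exists_biInf_eq_span_singleton {A ι : Type*} [CommRing A] [IsDomain A]
    [UniqueFactorizationMonoid A] (s : Finset ι) (Q : ι → Ideal A)
    (hQ : ∀ i ∈ s, ∃ c, Q i = Ideal.span {c}) : ∃ c, ⨅ i ∈ s, Q i = Ideal.span {c} := by
  classical
  let := UniqueFactorizationMonoid.toGCDMonoid A
  induction s using Finset.induction_on with
  | empty => exact ⟨1, by simp⟩
  | insert a s ha ih =>
    obtain ⟨c, hc⟩ := ih fun i hi => hQ i (Finset.mem_insert_of_mem hi)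
    obtain ⟨b, hb⟩ := hQ a (Finset.mem_insert_self a s)
    refine ⟨lcm b c, ?_⟩
    rw [Finset.iInf_insert, hc, hb]
    ext x
    simp [Ideal.mem_span_singleton, lcm_dvd_iff]

theorem exists_unmixedPart_eq_span_singleton {A : Type*} [CommRing A] [IsDomain A]
    [UniqueFactorizationMonoid A] [IsNoetherianRing A] {m : ℕ}
    (hA : ringKrullDim A ≤ (m + 1 : ℕ)) {J : Ideal A} (hJ : J ≠ ⊥)
    (hdim : (m : WithBot ℕ∞) ≤ ringKrullDim (A ⧸ J)) :
    ∃ c, unmixedPart J = Ideal.span {c} := by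
  classical
  let s : Set (PrimeSpectrum A) := {P | P.asIdeal ∈ J.minimalPrimes ∧
    ringKrullDim (A ⧸ P.asIdeal) = ringKrullDim (A ⧸ J)}
  have hs : s.Finite := ((J.finite_minimalPrimes_of_isNoetherianRing A).preimage
    (fun _ _ _ _ h => PrimeSpectrum.ext h)).subset fun P hP => hP.1
  obtain ⟨c, hc⟩ := exists_biInf_eq_span_singleton hs.toFinset (fun P : PrimeSpectrum A =>
    (J.map (algebraMap A (Localization.AtPrime P.asIdeal))).comap
      (algebraMap A (Localization.AtPrime P.asIdeal))) (by
    intro P hP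
    obtain ⟨hmin, hPdim⟩ := hs.mem_toFinset.1 hP
    have hP0 : P.asIdeal ≠ ⊥ := fun h => hJ (le_bot_iff.1 (h ▸ hmin.1.2))
    obtain ⟨q, hqP, hq⟩ := P.isPrime.exists_mem_prime_of_ne_bot hP0
    exact exists_comap_map_localization_eq_span_singleton hJ hq
      (eq_span_singleton_of_le_ringKrullDim_quotient hA (hPdim ▸ hdim) hq hqP))
  refine ⟨c, hc ▸ le_antisymm ?_ ?_⟩
  · exact le_iInf₂ fun P hP => iInf_le_of_le P.asIdeal
      (iInf₂_le P.isPrime (hs.mem_toFinset.1 hP))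
  · exact le_iInf fun P => le_iInf₂ fun hP hPs =>
      iInf₂_le (⟨P, hP⟩ : PrimeSpectrum A) (hs.mem_toFinset.2 hPs)

theorem le_unmixedPart {A : Type*} [CommRing A] (J : Ideal A) : J ≤ unmixedPart J :=
  le_iInf fun _ => le_iInf₂ fun _ _ => Ideal.le_comap_map

/-- Finiteness of the dimension makes `dim A/J` a maximum over the minimal primes of `J`, so that
the intersection defining the unmixed part is not over the empty family. -/
theorem unmixedPart_ne_top {A : Type*} [CommRing A] {J : Ideal A} (hA : ringKrullDim A < ⊤)
    (hJ : J ≠ ⊤) : unmixedPart J ≠ ⊤ := by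
  obtain ⟨P, hP, hPJ⟩ : ∃ P : Ideal A, P ∈ J.minimalPrimes ∧
      ringKrullDim (A ⧸ P) = ringKrullDim (A ⧸ J) := by
    have := Ideal.Quotient.nontrivial_iff.2 hJ
    obtain ⟨l, hl⟩ : ∃ l : LTSeries (PrimeSpectrum.zeroLocus (J : Set A)),
        (l.length : WithBot ℕ∞) = ringKrullDim (A ⧸ J) := by
      have hlt := (ringKrullDim_quotient_le J).trans_lt hA
      obtain ⟨N, hN⟩ : ∃ N : ℕ, (N : WithBot ℕ∞) = ringKrullDim (A ⧸ J) := by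
        obtain ⟨b, hb⟩ := WithBot.ne_bot_iff_exists.1 
          (Order.krullDim_ne_bot_iff.2 inferInstance : ringKrullDim (A ⧸ J) ≠ ⊥)
        change b = ringKrullDim (A ⧸ J) at hb
        rw [← hb] at hlt ⊢
        obtain ⟨N, rfl⟩ := ENat.ne_top_iff_exists.1 (WithBot.coe_lt_coe.1 hlt).ne
        exact ⟨N, rfl⟩
      obtain ⟨l, hl⟩ := Order.le_krullDim_iff.1 (hN.trans (ringKrullDim_quotient J)).le
      exact ⟨l, by rw [hl, hN]⟩
    obtain ⟨P, hP, hPl⟩ := Ideal.exists_minimalPrimes_le (J := l.head.1.asIdeal) (I := J) l.head.2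
    refine ⟨P, hP, le_antisymm ?_ ?_⟩
    · exact ringKrullDim_le_of_surjective _ (Ideal.Quotient.factor_surjective hP.1.2)
    · rw [← hl, ringKrullDim_quotient]
      refine Order.LTSeries.length_le_krullDim (α := PrimeSpectrum.zeroLocus (P : Set A))
        { length := l.length
          toFun := fun i => ⟨(l i).1, hPl.trans (l.monotone (Fin.zero_le i))⟩
          step := fun i => l.step i }
  have := hP.1.1
  refine fun h => this.ne_top (top_le_iff.1 ?_)
  rw [← h]
  refine (iInf_le_of_le P (iInf₂_le this ⟨hP, hPJ⟩)).trans fun x hx => ?_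
  rw [Ideal.mem_comap, IsLocalization.algebraMap_mem_map_algebraMap_iff P.primeCompl] at hx
  obtain ⟨s, hs, hsx⟩ := hx
  exact (this.mem_or_mem (hP.1.2 hsx)).resolve_left hs

end Unmixed

/-! ### Fiber ideals and minors -/

section Fibers

variable {k : Type*} [Field k] {m n d : ℕ} {f : Fin (n + 1) → CoordRing k m}

theorem minor_mem_fiberIdeal (f : Fin (n + 1) → CoordRing k m) (p : Fin (n + 1) → k)
    (i j : Fin (n + 1)) : C (p i) * f j - C (p j) * f i ∈ fiberIdeal f p := by
  have hker : (C (f j) * X i - C (f i) * X j : MvPolynomial (Fin (n + 1)) (CoordRing k m)) ∈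
      RingHom.ker (reesMap f) := by
    rw [RingHom.mem_ker, map_sub, map_mul, map_mul]
    refine Subtype.ext ?_
    simp [reesMap, Polynomial.C_mul_monomial, mul_comm]
  have := Ideal.mem_map_of_mem (eval fun j => (C (p j) : CoordRing k m)) hker
  simpa [fiberIdeal, mul_comm] using this

/-- If all minors vanished, then `f i` would divide every `f j` and hence be a constant. -/
theorem IsParameterization.exists_minor_ne_zero (hf : IsParameterization f d) (hd : 1 ≤ d)
    {p : Fin (n + 1) → k} {i : Fin (n + 1)} (hi : p i ≠ 0) :
    ∃ j, C (p i) * f j - C (p j) * f i ≠ 0 := by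
  by_contra! h
  have hu : IsUnit (f i) := hf.isUnit_of_dvd _ fun j =>
    (((IsUnit.mk0 _ hi).map C).dvd_mul_left).1 ((sub_eq_zero.1 (h j)) ▸ dvd_mul_left _ _)
  have h0 := (hf.isHomogeneous i).totalDegree hu.ne_zero
  rw [(MvPolynomial.isUnit_iff_totalDegree_of_isReduced.1 hu).2] at h0
  omega

theorem IsParameterization.isRelPrime_of_dvd_minors (hf : IsParameterization f d)
    {p : Fin (n + 1) → k} {i : Fin (n + 1)} (hi : p i ≠ 0) {h : CoordRing k m}
    (hdvd : ∀ j, h ∣ C (p i) * f j - C (p j) * f i) : IsRelPrime h (f i) := by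
  intro q hqh hqf
  refine hf.isUnit_of_dvd _ fun j => ?_
  rw [← ((IsUnit.mk0 _ hi).map (C : k →+* CoordRing k m)).dvd_mul_left]
  exact (dvd_sub_left (hqf.mul_left _)).1 (hqh.trans (hdvd j))

theorem IsParameterization.isRelPrime_of_dvd_minors_of_ne (hf : IsParameterization f d)
    {y y' : ℙ k (Fin (n + 1) → k)} (hy : y ≠ y') {h h' : CoordRing k m}
    (hdvd : ∀ i j, h ∣ C (y.rep i) * f j - C (y.rep j) * f i)
    (hdvd' : ∀ i j, h' ∣ C (y'.rep i) * f j - C (y'.rep j) * f i) : IsRelPrime h h' := by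
  intro q hqh hqh'
  have hmin : ∃ i j, y.rep i * y'.rep j - y.rep j * y'.rep i ≠ 0 := by
    by_contra! hzero
    obtain ⟨i, hi⟩ := Function.ne_iff.1 y.rep_nonzero
    obtain ⟨j, hj⟩ := Function.ne_iff.1 y'.rep_nonzero
    refine hy ?_
    rw [← y.mk_rep, ← y'.mk_rep, Projectivization.mk_eq_mk_iff']
    refine ⟨y.rep i / y'.rep i, funext fun l => ?_⟩
    have hi' : y'.rep i ≠ 0 := fun h0 => by
      have := hzero i j
      simp only [h0, mul_zero, sub_zero, mul_eq_zero] at this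
      exact this.elim hi hj
    have := hzero i l
    simp only [Pi.smul_apply, smul_eq_mul]
    field_simp
    linear_combination this
  obtain ⟨i, j, hij⟩ := hmin
  -- Eliminating `f i` and `f j` shows that `q` divides a nonzero scalar multiple of each `f l`.
  have hunit := (IsUnit.mk0 _ hij).map (C : k →+* CoordRing k m)
  refine hf.isUnit_of_dvd _ fun l => hunit.dvd_mul_left.1 ?_
  have key : C (y.rep i * y'.rep j - y.rep j * y'.rep i) * f l =
      C (y'.rep j) * (C (y.rep i) * f l - C (y.rep l) * f i) -
        C (y'.rep i) * (C (y.rep j) * f l - C (y.rep l) * f j) -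
        C (y.rep l) * (C (y'.rep i) * f j - C (y'.rep j) * f i) := by
    rw [C_sub, C_mul, C_mul]
    ring
  rw [key]
  exact dvd_sub (dvd_sub ((hqh.trans (hdvd i l)).mul_left _) ((hqh.trans (hdvd j l)).mul_left _))
    ((hqh'.trans (hdvd' i j)).mul_left _)

theorem pow_le_span_pair {A : Type*} [CommRing A] {I : Ideal A} {g h : A}
    (hI : I ≤ Ideal.span {g, h}) (s : ℕ) : I ^ s ≤ Ideal.span {g ^ s, h} := by
  induction s with
  | zero => simp [Ideal.span_insert]
  | succ s ih =>
    rw [pow_succ, Ideal.mul_le]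
    intro x hx y hy
    obtain ⟨a, b, rfl⟩ := Ideal.mem_span_pair.1 (ih hx)
    obtain ⟨a', b', rfl⟩ := Ideal.mem_span_pair.1 (hI hy)
    exact Ideal.mem_span_pair.2 ⟨a * a', b * (a' * g + b' * h) + a * g ^ s * b', by ring⟩

/-- The key step: a form of degree less than `s d` in the saturation of `I ^ s` is divisible by
every form dividing the minors of `f` and a point. -/
theorem IsParameterization.dvd_of_mem_saturation (hf : IsParameterization f d) (hm : 2 ≤ m)
    {p : Fin (n + 1) → k} {i : Fin (n + 1)} (hi : p i ≠ 0) {h : CoordRing k m} {e : ℕ}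
    (hh : h.IsHomogeneous e) (hh0 : h ≠ 0)
    (hdvd : ∀ j, h ∣ C (p i) * f j - C (p j) * f i) {s ν : ℕ} (hν : ν < s * d)
    {F : CoordRing k m} (hF : F.IsHomogeneous ν) (hmem : F ∈ saturation (baseIdeal f ^ s)) :
    h ∣ F := by
  have hI : baseIdeal f ≤ Ideal.span {f i, h} := by
    refine Ideal.span_le.2 ?_
    rintro _ ⟨j, rfl⟩
    obtain ⟨c, hc⟩ := hdvd j
    have hone : (C (p i)⁻¹ * C (p i) : CoordRing k m) = 1 := by
      rw [← C_mul, inv_mul_cancel₀ hi, C_1]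
    exact Ideal.mem_span_pair.2 ⟨C (p i)⁻¹ * C (p j), C (p i)⁻¹ * c, by
      linear_combination f j * hone - C (p i)⁻¹ * hc⟩
  have hG := (hf.isHomogeneous i).pow s
  refine dvd_of_isHomogeneous_of_mem_span_pair hF hG hh (by rwa [mul_comm]) ?_
  exact saturation_le_span_pair hm hh0 (hf.isRelPrime_of_dvd_minors hi hdvd).pow_right
    (pow_le_span_pair hI s) hmem

theorem projLocus_nonempty_of_mem_fiberDimSet {l : ℕ} {y : ℙ k (Fin (n + 1) → k)}
    (hy : y ∈ fiberDimSet f l) : (projLocus (fiberIdeal f y.rep)).Nonempty := by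
  have hy' : topologicalKrullDim (projLocus (fiberIdeal f y.rep)) = l := hy
  have hne : topologicalKrullDim (projLocus (fiberIdeal f y.rep)) ≠ ⊥ := by
    rw [hy']; exact WithBot.coe_ne_bot
  obtain ⟨Z⟩ := Order.krullDim_ne_bot_iff.1 hne
  obtain ⟨z, -⟩ := Z.isIrreducible'.1
  exact ⟨z.1, z.2⟩

theorem fiberIdeal_ne_top_of_mem_fiberDimSet {l : ℕ} {y : ℙ k (Fin (n + 1) → k)}
    (hy : y ∈ fiberDimSet f l) : fiberIdeal f y.rep ≠ ⊤ := by
  intro h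
  obtain ⟨z, hz⟩ := projLocus_nonempty_of_mem_fiberDimSet hy
  rw [h] at hz
  exact z.isPrime.ne_top (top_le_iff.1 fun _ hx => hz hx)

theorem ringKrullDim_coordRing : ringKrullDim (CoordRing k m) = (m + 1 : ℕ) := by
  rw [MvPolynomial.ringKrullDim_of_isNoetherianRing, ringKrullDim_eq_zero_of_field]
  simp

theorem IsFiberEquation.dvd_minor {y : ℙ k (Fin (n + 1) → k)} {h : CoordRing k m}
    (hh : IsFiberEquation f y h) (i j : Fin (n + 1)) :
    h ∣ C (y.rep i) * f j - C (y.rep j) * f i := by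
  rw [← Ideal.mem_span_singleton, hh.2]
  exact le_unmixedPart _ (minor_mem_fiberIdeal f _ i j)

theorem IsParameterization.isFiberEquation_ne_zero (hf : IsParameterization f d) (hd : 1 ≤ d)
    {y : ℙ k (Fin (n + 1) → k)} {h : CoordRing k m} (hh : IsFiberEquation f y h) : h ≠ 0 := by
  rintro rfl
  obtain ⟨i, hi⟩ := Function.ne_iff.1 y.rep_nonzero
  obtain ⟨j, hj⟩ := hf.exists_minor_ne_zero hd hi
  exact hj (zero_dvd_iff.1 (hh.dvd_minor i j))

theorem IsFiberEquation.one_le_totalDegree {l : ℕ} {y : ℙ k (Fin (n + 1) → k)}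
    (hy : y ∈ fiberDimSet f l) {h : CoordRing k m} (hh : IsFiberEquation f y h) (hh0 : h ≠ 0) :
    1 ≤ h.totalDegree := by
  rw [Nat.one_le_iff_ne_zero]
  intro h0
  rw [totalDegree_eq_zero_iff_eq_C] at h0
  have hu : IsUnit h := by
    rw [h0]
    refine (IsUnit.mk0 _ fun hc => hh0 ?_).map C
    rw [h0, hc, C_0]
  refine unmixedPart_ne_top (J := fiberIdeal f y.rep) ?_
    (fiberIdeal_ne_top_of_mem_fiberDimSet hy) ?_
  · rw [ringKrullDim_coordRing]
    exact WithBot.coe_lt_coe.2 (ENat.natCast_lt_top _)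
  · rw [← hh.2, Ideal.span_singleton_eq_top]
    exact hu

theorem IsParameterization.exists_isFiberEquation (hf : IsParameterization f d) (hd : 1 ≤ d)
    (hm : 1 ≤ m) {y : ℙ k (Fin (n + 1) → k)} (hy : y ∈ fiberDimSet f (m - 1)) :
    ∃ h, IsFiberEquation f y h := by
  obtain ⟨i, hi⟩ := Function.ne_iff.1 y.rep_nonzero
  obtain ⟨j, hj⟩ := hf.exists_minor_ne_zero hd hi
  have hg := minor_mem_fiberIdeal f y.rep i j
  have hdim : (m : WithBot ℕ∞) ≤ ringKrullDim (CoordRing k m ⧸ fiberIdeal f y.rep) := by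
    refine le_trans ?_
      (topologicalKrullDim_projLocus_add_one_le (projLocus_nonempty_of_mem_fiberDimSet hy))
    have hy' : topologicalKrullDim (projLocus (fiberIdeal f y.rep)) = (m - 1 : ℕ) := hy
    rw [hy']
    exact_mod_cast (Nat.sub_add_cancel hm).ge
  obtain ⟨h, hh⟩ := exists_unmixedPart_eq_span_singleton ringKrullDim_coordRing.le
    (fun h0 => hj (by simpa [h0] using hg)) hdim
  refine ⟨h, isHomogeneous_of_dvd (D := d) ?_ hj ?_, hh.symm⟩
  · exact ((hf.isHomogeneous j).C_mul _).sub ((hf.isHomogeneous i).C_mul _)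
  · rw [← Ideal.mem_span_singleton, ← hh]
    exact le_unmixedPart _ hg

end Fibers

/-! ### Coprime divisors of a polynomial -/

theorem sum_totalDegree_le_of_dvd {k σ ι : Type*} [Field k] {F : MvPolynomial σ k} (hF : F ≠ 0)
    {h : ι → MvPolynomial σ k} (t : Finset ι) (hdvd : ∀ y ∈ t, h y ∣ F)
    (hrel : (t : Set ι).Pairwise (Function.onFun IsRelPrime h)) :
    ∑ y ∈ t, (h y).totalDegree ≤ F.totalDegree := by
  classical
  have hne : ∀ y ∈ t, h y ≠ 0 := fun y hy h0 => hF (zero_dvd_iff.1 (h0 ▸ hdvd y hy))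
  have hprod : ∑ y ∈ t, (h y).totalDegree = (∏ y ∈ t, h y).totalDegree := by
    clear hdvd hrel
    induction t using Finset.induction_on with
    | empty => simp
    | insert a t ha ih =>
      rw [Finset.sum_insert ha, Finset.prod_insert ha, ih fun y hy => hne y (by simp [hy]),
        totalDegree_mul_of_isDomain (hne a (by simp))
          (Finset.prod_ne_zero_iff.2 fun y hy => hne y (by simp [hy]))]
  rw [hprod]
  exact totalDegree_le_of_dvd_of_isDomain (Finset.prod_dvd_of_isRelPrime hrel hdvd) hF

theorem finite_and_finsum_totalDegree_le_of_dvd {k σ ι : Type*} [Field k] {F : MvPolynomial σ k}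
    (hF : F ≠ 0) {h : ι → MvPolynomial σ k} {S : Set ι} (hdvd : ∀ y ∈ S, h y ∣ F)
    (hrel : S.Pairwise (Function.onFun IsRelPrime h)) (hdeg : ∀ y ∈ S, 1 ≤ (h y).totalDegree) :
    S.Finite ∧ ∑ᶠ y ∈ S, (h y).totalDegree ≤ F.totalDegree := by
  have hle : ∀ t : Finset ι, (t : Set ι) ⊆ S → ∑ y ∈ t, (h y).totalDegree ≤ F.totalDegree :=
    fun t ht => sum_totalDegree_le_of_dvd hF t (fun y hy => hdvd y (ht hy)) (hrel.mono ht)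
  have hS : S.Finite := by
    by_contra hinf
    obtain ⟨t, htS, ht⟩ := Set.Infinite.exists_subset_card_eq hinf (F.totalDegree + 1)
    have h1 : t.card ≤ ∑ y ∈ t, (h y).totalDegree := by
      simpa using Finset.card_nsmul_le_sum t _ 1 fun y hy => hdeg y (htS hy)
    have := hle t htS
    omega
  refine ⟨hS, ?_⟩
  rw [finsum_mem_eq_finite_toFinset_sum _ hS]
  exact hle _ (by simp)

/-! ### The degree bound -/

theorem IsParameterization.finite_and_finsum_totalDegree_le {k : Type*} [Field k] {m n d : ℕ}
    {f : Fin (n + 1) → CoordRing k m} (hf : IsParameterization f d) (hm : 2 ≤ m) (hd : 1 ≤ d)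
    {h : ℙ k (Fin (n + 1) → k) → CoordRing k m}
    (hh : ∀ y ∈ fiberDimSet f (m - 1), IsFiberEquation f y (h y)) {s ν : ℕ}
    (hν : indeg (saturation (baseIdeal f ^ s)) = (ν : ℕ∞)) (hlt : ν < s * d) :
    (fiberDimSet f (m - 1)).Finite ∧
      ∑ᶠ y ∈ fiberDimSet f (m - 1), (h y).totalDegree ≤ ν := by
  obtain ⟨F, hFmem, hF0, hF⟩ := exists_of_indeg_eq hν
  have hne : ∀ y ∈ fiberDimSet f (m - 1), h y ≠ 0 := fun y hy =>
    hf.isFiberEquation_ne_zero hd (hh y hy)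
  rw [← hF.totalDegree hF0]
  refine finite_and_finsum_totalDegree_le_of_dvd hF0 (fun y hy => ?_)
    (fun y hy y' hy' hyy => hf.isRelPrime_of_dvd_minors_of_ne hyy (hh y hy).dvd_minor
      (hh y' hy').dvd_minor)
    fun y hy => (hh y hy).one_le_totalDegree hy (hne y hy)
  obtain ⟨i, hi⟩ := Function.ne_iff.1 y.rep_nonzero
  exact hf.dvd_of_mem_saturation hm hi (hh y hy).1 (hne y hy) ((hh y hy).dvd_minor i) hlt hF hFmem

end RationalMapFibers

theorem theorem1p3 {k : Type*} [Field k] [IsAlgClosed k] (m n d : ℕ) (hm : 2 ≤ m) (hmn : m ≤ n)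
    (hd : 1 ≤ d) (f : Fin (n + 1) → RationalMapFibers.CoordRing k m)
    (hf : RationalMapFibers.IsParameterization f d) :
    (∀ y ∈ RationalMapFibers.fiberDimSet f (m - 1),
      ∃ h, RationalMapFibers.IsFiberEquation f y h) ∧
    ∀ h : ℙ k (Fin (n + 1) → k) → RationalMapFibers.CoordRing k m,
      (∀ y ∈ RationalMapFibers.fiberDimSet f (m - 1),
        RationalMapFibers.IsFiberEquation f y (h y)) →
      (∀ s : ℕ, 1 ≤ s → ∀ ν : ℕ,
        RationalMapFibers.indeg
          (RationalMapFibers.saturation (RationalMapFibers.baseIdeal f ^ s)) = (ν : ℕ∞) →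
        ν < s * d →
        (RationalMapFibers.fiberDimSet f (m - 1)).Finite ∧
        ∑ᶠ y ∈ RationalMapFibers.fiberDimSet f (m - 1), (h y).totalDegree ≤ ν ∧
        ∑ᶠ y ∈ RationalMapFibers.fiberDimSet f (m - 1), (h y).totalDegree < s * d) ∧
      (RationalMapFibers.indeg
          (RationalMapFibers.saturation (RationalMapFibers.baseIdeal f)) < (d : ℕ∞) →
        (RationalMapFibers.fiberDimSet f (m - 1)).Finite ∧
        ∑ᶠ y ∈ RationalMapFibers.fiberDimSet f (m - 1), (h y).totalDegree < d)
  := by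
  refine ⟨fun y hy => hf.exists_isFiberEquation hd (by omega) hy, fun h hh => ⟨?_, ?_⟩⟩
  · intro s _ ν hν hlt
    obtain ⟨hfin, hle⟩ := hf.finite_and_finsum_totalDegree_le hm hd hh hν hlt
    exact ⟨hfin, hle, hle.trans_lt hlt⟩
  · intro hlt
    obtain ⟨ν, hν⟩ := ENat.ne_top_iff_exists.1 hlt.ne_top
    rw [← hν] at hlt
    obtain ⟨hfin, hle⟩ := hf.finite_and_finsum_totalDegree_le hm hd hh (s := 1) (ν := ν)
      (by rw [pow_one, hν]) (by rw [one_mul]; exact_mod_cast hlt)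
    exact ⟨hfin, hle.trans_lt (by exact_mod_cast hlt)⟩
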